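/- Theorem (Strong converse). Let $\exp$ and $\log$ be to base $2$. Let $\mathcal X$ be a finite nonempty set with $a=|\mathcal X|$, let $\mathcal H$ be a complex Hilbert space of finite dimension $d$, and let a cq-channel $W$ assign to each $x\in\mathcal X$ a state (density operator) $W_x$ on $\mathcal H$. For a probability distribution $P$ on $\mathcal X$ put $PW=\sum_x P(x)W_x$ and $I(P;W)=H(PW)-\sum_x P(x)H(W_x)$, where $H(\rho)=-\operatorname{Tr}\rho\log\rho$, and let $C(W)=\max_P I(P;W)$. For $x^n=x_1\dots x_n\in\mathcal X^n$ put $W_{x^n}=W_{x_1}\otimes\cdots\otimes W_{x_n}$. For $n\ge 1$, an $(n,\lambda)$-code for $W$ is a pair $(f,D)$ of a map $f:\mathcal M\to\mathcal X^n$ on a finite set $\mathcal M$ and a family $D=(D_m)_{m\in\mathcal M'}$ of positive semidefinite operators on $\mathcal H^{\otimes n}$, indexed by a finite set $\mathcal M'\supset\mathcal M$, with $\sum_{m\in\mathcal M'}D_m=\mathbf 1$ and $1-\operatorname{Tr}(W_{f(m)}D_m)\le\lambda$ for all $m\in\mathcal M$. For every $\lambda\in(0,1)$ the following hold. (1) For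 all $a,d$ there is a constant $K(\lambda,a,d)$ such that for all $\mathcal X$, $\mathcal H$ with $|\mathcal X|=a$ and $\dim\mathcal H=d$, every cq-channel $W$, every $n\ge1$ and every $(n,\lambda)$-code $(f,D)$ for $W$, $$|\mathcal M|\le\exp\left(nC(W)+K(\lambda,a,d)\sqrt n\right).$$ (2) If, in addition, all codewords $f(m)$, $m\in\mathcal M$, are of the same type $P$ (that is, $P$ is a probability distribution with $|\{i: f(m)_i=x\}|=nP(x)$ for all $x\in\mathcal X$ and $m\in\mathcal M$), then $$|\mathcal M|\le\frac{4}{1-\lambda}\exp\left(nI(P;W)+2\kappa d\sqrt a\,\delta\sqrt n\right),\qquad \delta=\frac{\sqrt{32ad}}{1-\lambda},\quad \kappa=\frac{2\log e}{e}.$$ -/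

import Mathlib

open scoped Matrix ComplexOrder

noncomputable section

namespace CQ

/-- States (density operators) on the finite-dimensional Hilbert space `ℂ^ι`: positive
semidefinite matrices of trace one. -/
structure State (ι : Type*) [Fintype ι] where
  mat : Matrix ι ι ℂ
  posSemidef : mat.PosSemidef
  trace_eq_one : mat.trace = 1

/-- The von Neumann entropy `-Tr ρ log₂ ρ = -∑ R(j) log₂ R(j)`, with `R` the list of eigenvalues of
`ρ` with multiplicities (and `0 log₂ 0 = 0`). -/
def State.entropy {ι : Type*} [Fintype ι] [DecidableEq ι] (ρ : State ι) : ℝ :=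
  -∑ j, ρ.posSemidef.isHermitian.eigenvalues j *
    Real.logb 2 (ρ.posSemidef.isHermitian.eigenvalues j)

/-- A discrete memoryless classical-quantum channel with input alphabet `X` and output
system `ℂ^ι`. -/
abbrev Channel (X ι : Type*) [Fintype ι] := X → State ι

section Information

variable {X ι : Type*} [Fintype X] [Fintype ι]

/-- The average output state `PW = ∑ P(x) W_x`. -/
def avgState (P : stdSimplex ℝ X) (W : Channel X ι) : State ι where
  mat := ∑ x, (P.1 x : ℂ) • (W x).mat
  posSemidef := by
    refine Matrix.posSemidef_sum _ fun x _ => (W x).posSemidef.smul ?_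
    exact_mod_cast P.2.1 x
  trace_eq_one := by
    simp only [Matrix.trace_sum, Matrix.trace_smul, (W _).trace_eq_one, smul_eq_mul, mul_one]
    exact_mod_cast P.2.2

variable [DecidableEq ι]

/-- The conditional von Neumann entropy `H(W|P) = ∑ P(x) H(W_x)`. -/
def condEntropy (P : stdSimplex ℝ X) (W : Channel X ι) : ℝ :=
  ∑ x, P.1 x * (W x).entropy

/-- The mutual information `I(P;W) = H(PW) - H(W|P)`. -/
def mutualInfo (P : stdSimplex ℝ X) (W : Channel X ι) : ℝ :=
  (avgState P W).entropy - condEntropy P W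

/-- `C(W)`, the maximum of `I(P;W)` over all probability distributions `P` on `X`. -/
def capacity (W : Channel X ι) : ℝ :=
  ⨆ P : stdSimplex ℝ X, mutualInfo P W

/-- The supremum that defines `C(W)` is that of a bounded set, so it is not a default value. -/
theorem bddAbove_mutualInfo (W : Channel X ι) :
    BddAbove (Set.range fun P : stdSimplex ℝ X => mutualInfo P W) := by
  have key : ∀ ρ : State ι, ∀ j, 0 ≤ ρ.posSemidef.isHermitian.eigenvalues j ∧
      ρ.posSemidef.isHermitian.eigenvalues j ≤ 1 := by
    intro ρ j
    refine ⟨ρ.posSemidef.eigenvalues_nonneg j, ?_⟩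
    have h := ρ.posSemidef.isHermitian.trace_eq_sum_eigenvalues
    rw [ρ.trace_eq_one] at h
    have h' : (1 : ℝ) = ∑ i, ρ.posSemidef.isHermitian.eigenvalues i := by
      have h2 := congrArg Complex.re h
      simpa using h2
    rw [h']
    exact Finset.single_le_sum (fun i _ => ρ.posSemidef.eigenvalues_nonneg i) (Finset.mem_univ j)
  have hl : 0 < Real.log 2 := Real.log_pos one_lt_two
  have hnonneg : ∀ ρ : State ι, 0 ≤ ρ.entropy := by
    intro ρ
    rw [State.entropy, neg_nonneg]
    exact Finset.sum_nonpos fun j _ => mul_nonpos_of_nonneg_of_nonpos (key ρ j).1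
      (Real.logb_nonpos one_lt_two (key ρ j).1 (key ρ j).2)
  have hle : ∀ ρ : State ι, ρ.entropy ≤ ∑ _j : ι, 1 / Real.log 2 := by
    intro ρ
    rw [State.entropy, ← Finset.sum_neg_distrib]
    refine Finset.sum_le_sum fun j _ => ?_
    obtain ⟨h0, h1⟩ := key ρ j
    rw [Real.logb, ← mul_div_assoc, ← neg_div]
    refine div_le_div_of_nonneg_right ?_ hl.le
    rcases h0.eq_or_lt with h | h
    · rw [← h]; simp
    · have := Real.abs_log_mul_self_lt _ h h1
      rw [abs_lt] at this
      nlinarith [this.1]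
  refine ⟨∑ _j : ι, 1 / Real.log 2, ?_⟩
  rintro _ ⟨P, rfl⟩
  have h2 : 0 ≤ condEntropy P W :=
    Finset.sum_nonneg fun x _ => mul_nonneg (P.2.1 x) (hnonneg _)
  have h3 := hle (avgState P W)
  simp only [mutualInfo]
  linarith

end Information

/-- The tensor product `A_1 ⊗ ⋯ ⊗ A_n`, an operator on `(ℂ^ι)^{⊗n} = ℂ^(ι^n)`. -/
def tensorPow {ι : Type*} {n : ℕ} (A : Fin n → Matrix ι ι ℂ) :
    Matrix (Fin n → ι) (Fin n → ι) ℂ :=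
  Matrix.of fun j k => ∏ i, A i (j i) (k i)

/-- The output `W_{x^n} = W_{x_1} ⊗ ⋯ ⊗ W_{x_n}` for the input sequence `x^n`. -/
def output {X ι : Type*} [Fintype ι] {n : ℕ} (W : Channel X ι) (xs : Fin n → X) :
    Matrix (Fin n → ι) (Fin n → ι) ℂ :=
  tensorPow fun i => (W (xs i)).mat

/-- An `n`-block code `(f, D)`: the encoder `f` maps a set `messages` into `X^n`, and `D` is an
observable on the `n`-fold tensor power of `ℂ^ι`, i.e. a partition of the identity into positive
operators, indexed by a finite set `M'` that contains `messages`. -/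
structure BlockCode (X ι M' : Type*) [Fintype ι] [DecidableEq ι] [Fintype M'] (n : ℕ) where
  messages : Finset M'
  f : messages → (Fin n → X)
  D : M' → Matrix (Fin n → ι) (Fin n → ι) ℂ
  posSemidef : ∀ m, (D m).PosSemidef
  sum_eq_one : ∑ m, D m = 1

namespace BlockCode

variable {X ι M' : Type*} [Fintype ι] [DecidableEq ι] [Fintype M'] {n : ℕ}

/-- The maximum error probability `max {1 - Tr (W_{f(m)} D_m) : m ∈ messages}`
(`0` if there are no messages). -/
def errorProb (c : BlockCode X ι M' n) (W : Channel X ι) : ℝ :=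
  ⨆ m : c.messages, (1 - ((output W (c.f m) * c.D m).trace).re)

/-- `(f, D)` is an `(n, lam)`-code for the channel `W`. -/
def IsCode (c : BlockCode X ι M' n) (W : Channel X ι) (lam : ℝ) : Prop :=
  c.errorProb W ≤ lam

end BlockCode

/-- The type of a sequence `x^n`, i.e. its empirical distribution
`x ↦ |{i : x_i = x}| / n`. -/
def seqType {X : Type*} [DecidableEq X] {n : ℕ} (xs : Fin n → X) : X → ℝ :=
  fun x => ((Finset.univ.filter fun i => xs i = x).card : ℝ) / n

/-- The constant `2 (log₂ e) / e`. -/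
def entropyConst : ℝ := 2 * Real.logb 2 (Real.exp 1) / Real.exp 1

end CQ

end

noncomputable section

namespace CQ

section LinearAlgebra

variable {N : Type*}

theorem re_diag_nonneg {A : Matrix N N ℂ} (hA : A.PosSemidef) (j : N) : 0 ≤ (A j j).re := by
  have h := hA.diag_nonneg (i := j)
  exact (Complex.nonneg_iff.mp h).1

theorem re_diag_le_one [DecidableEq N] {A : Matrix N N ℂ} (hA : (1 - A).PosSemidef) (j : N) : (A j j).re ≤ 1 := by
  have h := re_diag_nonneg hA j
  simpa using h

variable [Fintype N] [DecidableEq N]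

theorem re_trace_conj_diagonal_mul (U A : Matrix N N ℂ) (r : N → ℝ) :
    ((U * Matrix.diagonal (fun j => (r j : ℂ)) * Uᴴ * A).trace).re
      = ∑ j, r j * ((Uᴴ * A * U) j j).re := by
  rw [show U * Matrix.diagonal (fun j => (r j : ℂ)) * Uᴴ * A
    = U * (Matrix.diagonal (fun j => (r j : ℂ)) * Uᴴ * A) by simp only [Matrix.mul_assoc],
    Matrix.trace_mul_comm]
  rw [show Matrix.diagonal (fun j => (r j : ℂ)) * Uᴴ * A * U
    = Matrix.diagonal (fun j => (r j : ℂ)) * (Uᴴ * A * U) by simp only [Matrix.mul_assoc]]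
  simp [Matrix.trace, Matrix.diagonal_mul]

/-- The trace of a product of positive semidefinite matrices is nonnegative. -/
theorem re_trace_mul_nonneg {A B : Matrix N N ℂ} (hA : A.PosSemidef) (hB : B.PosSemidef) :
    0 ≤ ((A * B).trace).re := by
  have h := hA.isHermitian.spectral_theorem
  rw [Unitary.conjStarAlgAut_apply] at h
  rw [h]
  refine (re_trace_conj_diagonal_mul (hA.isHermitian.eigenvectorUnitary : Matrix N N ℂ) B
    hA.isHermitian.eigenvalues).symm ▸ ?_
  exact Finset.sum_nonneg fun j _ => mul_nonneg (hA.eigenvalues_nonneg j)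
    (re_diag_nonneg (hB.conjTranspose_mul_mul_same _) j)

/-- An effect `B` has weight at most `μ Tr B + ε` in a state whose eigenvalues exceed `μ` with
total weight at most `ε`. -/
theorem re_trace_mul_le_of_eigenvalues {U B : Matrix N N ℂ} (hU : U * Uᴴ = 1) {r : N → ℝ}
    (hB : B.PosSemidef) (hB1 : (1 - B).PosSemidef) {μ ε : ℝ} (hμ : 0 ≤ μ)
    (hε : ∑ j with μ < r j, r j ≤ ε) :
    ((U * Matrix.diagonal (fun j => (r j : ℂ)) * Uᴴ * B).trace).re ≤ μ * B.trace.re + ε := by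
  have hU' : Uᴴ * U = 1 := mul_eq_one_comm.mp hU
  rw [re_trace_conj_diagonal_mul]
  have htr : B.trace.re = ∑ j, ((Uᴴ * B * U) j j).re := by
    have : (Uᴴ * B * U).trace = B.trace := by
      rw [Matrix.trace_mul_comm, ← Matrix.mul_assoc, hU, Matrix.one_mul]
    rw [← this]; simp [Matrix.trace]
  have h0 : ∀ j, 0 ≤ ((Uᴴ * B * U) j j).re :=
    re_diag_nonneg (hB.conjTranspose_mul_mul_same U)
  have h1 : ∀ j, ((Uᴴ * B * U) j j).re ≤ 1 := by
    refine re_diag_le_one ?_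
    have := hB1.conjTranspose_mul_mul_same U
    rwa [Matrix.mul_sub, Matrix.sub_mul, Matrix.mul_one, hU'] at this
  refine le_trans ?_ (add_le_add_right hε _)
  rw [htr, Finset.mul_sum, Finset.sum_filter, ← Finset.sum_add_distrib]
  refine Finset.sum_le_sum fun j _ => ?_
  split_ifs with h
  · nlinarith [h0 j, h1 j, mul_nonneg hμ (h0 j)]
  · rw [add_zero]
    exact mul_le_mul_of_nonneg_right (not_lt.mp h) (h0 j)

/-- The pinching inequality `D ≤ 2 (QDQ + (1 - Q)D(1 - Q))`, tested against a state. -/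
theorem re_trace_mul_le_pinching {ρ D Q : Matrix N N ℂ} (hρ : ρ.PosSemidef) (hD : D.PosSemidef)
    (hD1 : (1 - D).PosSemidef) (hQ : Q.IsHermitian) (hQQ : Q * Q = Q) :
    ((ρ * D).trace).re ≤
      2 * ((ρ * (Q * D * Q)).trace).re + 2 * ((ρ * (1 - Q)).trace).re := by
  have hR : (1 - Q).IsHermitian := Matrix.isHermitian_one.sub hQ
  have hS : (2 • Q - 1).IsHermitian := (IsSelfAdjoint.smul (by simp) hQ).sub Matrix.isHermitian_one
  have e : (2 • Q - 1) * D * (2 • Q - 1) + D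
      = 2 • (Q * D * Q) + 2 • ((1 - Q) * D * (1 - Q)) := by
    noncomm_ring
  have e2 : (1 - Q) * (1 - D) * (1 - Q) = (1 - Q) - (1 - Q) * D * (1 - Q) := by
    have : (1 - Q) * (1 - Q) = 1 - Q := by
      rw [Matrix.mul_sub, Matrix.sub_mul, Matrix.sub_mul, hQQ]; simp
    rw [Matrix.mul_sub (1 - Q), Matrix.sub_mul (_ * _), Matrix.mul_one, this]
  have p1 := hD.mul_mul_conjTranspose_same (2 • Q - 1)
  rw [hS.eq] at p1
  have p2 := hD1.mul_mul_conjTranspose_same (1 - Q)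
  rw [hR.eq, e2] at p2
  have t1 := re_trace_mul_nonneg hρ p1
  have t2 := re_trace_mul_nonneg hρ p2
  have t3 : ((ρ * ((2 • Q - 1) * D * (2 • Q - 1))).trace).re + ((ρ * D).trace).re
      = 2 * ((ρ * (Q * D * Q)).trace).re + 2 * ((ρ * ((1 - Q) * D * (1 - Q))).trace).re := by
    rw [← Complex.add_re, ← Matrix.trace_add, ← Matrix.mul_add, e]
    simp [Matrix.mul_add, Matrix.trace_add, two_mul, two_smul]
  rw [Matrix.mul_sub ρ, Matrix.trace_sub, Complex.sub_re] at t2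
  linarith

end LinearAlgebra

section TensorPow

variable {ι : Type*} {n : ℕ}

theorem tensorPow_mul [Fintype ι] (A B : Fin n → Matrix ι ι ℂ) :
    tensorPow A * tensorPow B = tensorPow fun i => A i * B i := by
  ext j k
  simp only [tensorPow, Matrix.mul_apply, Matrix.of_apply, ← Finset.prod_mul_distrib]
  rw [Finset.prod_univ_sum, Fintype.piFinset_univ]

theorem tensorPow_conjTranspose (A : Fin n → Matrix ι ι ℂ) :
    (tensorPow A)ᴴ = tensorPow fun i => (A i)ᴴ := by
  ext j k
  simp [tensorPow, Matrix.conjTranspose_apply]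

theorem tensorPow_diagonal [DecidableEq ι] (r : Fin n → ι → ℂ) :
    tensorPow (fun i => Matrix.diagonal (r i))
      = Matrix.diagonal fun j : Fin n → ι => ∏ i, r i (j i) := by
  ext j k
  simp only [tensorPow, Matrix.of_apply, Matrix.diagonal_apply]
  by_cases h : j = k
  · subst h; simp
  · obtain ⟨i, hi⟩ := Function.ne_iff.mp h
    rw [if_neg h]
    exact Finset.prod_eq_zero (Finset.mem_univ i) (if_neg hi)

theorem tensorPow_one [DecidableEq ι] :
    tensorPow (fun _ : Fin n => (1 : Matrix ι ι ℂ)) = 1 := by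
  simpa using tensorPow_diagonal fun (_ : Fin n) (_ : ι) => (1 : ℂ)

end TensorPow

section Chebyshev

variable {ι : Type*} [Fintype ι] {n : ℕ}

theorem sum_prod_pi_eq_one {q : Fin n → ι → ℝ} (hq : ∀ i, ∑ j, q i j = 1) :
    ∑ j : Fin n → ι, ∏ i, q i (j i) = 1 := by
  classical
  rw [← Fintype.piFinset_univ, ← Finset.prod_univ_sum]
  simp [hq]

theorem sum_prod_mul_sq_sum {q h : Fin n → ι → ℝ} (hq : ∀ i, ∑ j, q i j = 1)
    (hh : ∀ i, ∑ j, q i j * h i j = 0) :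
    ∑ j : Fin n → ι, (∏ i, q i (j i)) * (∑ i, h i (j i)) ^ 2 = ∑ i, ∑ j, q i j * h i j ^ 2 := by
  classical
  have key : ∀ i k : Fin n, ∑ j : Fin n → ι, (∏ l, q l (j l)) * (h i (j i) * h k (j k))
      = if i = k then ∑ j, q i j * h i j ^ 2 else 0 := by
    intro i k
    have : ∀ j : Fin n → ι, (∏ l, q l (j l)) * (h i (j i) * h k (j k))
        = ∏ l, q l (j l) * ((if l = i then h l (j l) else 1) * if l = k then h l (j l) else 1) := by
      intro j
      rw [Finset.prod_mul_distrib, Finset.prod_mul_distrib]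
      simp
    simp_rw [this]
    rw [← Fintype.piFinset_univ, ← Finset.prod_univ_sum (fun _ => Finset.univ)
      fun l a => q l a * ((if l = i then h l a else 1) * if l = k then h l a else 1)]
    split_ifs with hik
    · subst hik
      rw [Finset.prod_eq_single i]
      · simp [sq]
      · intro l _ hl
        simp [hl, hq]
      · simp
    · refine Finset.prod_eq_zero (Finset.mem_univ i) ?_
      simpa [hik] using hh i
  simp_rw [sq (∑ i, h i _), Finset.sum_mul_sum, Finset.mul_sum]
  rw [Finset.sum_comm]
  refine Finset.sum_congr rfl fun i _ => ?_
  rw [Finset.sum_comm]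
  simp_rw [key]
  simp

/-- Chebyshev's inequality for a sum of independent random variables on a finite product. -/
theorem chebyshev_pi {q g : Fin n → ι → ℝ} (hq0 : ∀ i j, 0 ≤ q i j) (hq : ∀ i, ∑ j, q i j = 1)
    {t V : ℝ} (ht : 0 < t) (hV : ∑ i, ∑ j, q i j * g i j ^ 2 ≤ V) (S : Finset (Fin n → ι))
    (hS : ∀ j ∈ S, ∏ i, q i (j i) ≠ 0 →
      t ≤ |∑ i, g i (j i) - ∑ i, ∑ j, q i j * g i j|) :
    ∑ j ∈ S, ∏ i, q i (j i) ≤ V / t ^ 2 := by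
  set m : Fin n → ℝ := fun i => ∑ j, q i j * g i j with hm
  have hmean : ∀ i, ∑ j, q i j * (g i j - m i) = 0 := by
    intro i
    simp_rw [mul_sub, Finset.sum_sub_distrib, ← Finset.sum_mul, hq, one_mul]
    simp [hm]
  have hvar : ∀ i, ∑ j, q i j * (g i j - m i) ^ 2 ≤ ∑ j, q i j * g i j ^ 2 := by
    intro i
    have : ∑ j, q i j * (g i j - m i) ^ 2 = ∑ j, q i j * g i j ^ 2 - m i ^ 2 := by
      have e : ∀ j, q i j * (g i j - m i) ^ 2
          = q i j * g i j ^ 2 - 2 * m i * (q i j * g i j) + q i j * m i ^ 2 := fun j => by ring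
      simp_rw [e, Finset.sum_add_distrib, Finset.sum_sub_distrib, ← Finset.mul_sum,
        ← Finset.sum_mul, hq]
      rw [show ∑ j, q i j * g i j = m i from rfl]
      ring
    rw [this]
    linarith [sq_nonneg (m i)]
  have hp : ∀ j : Fin n → ι, 0 ≤ ∏ i, q i (j i) := fun j => Finset.prod_nonneg fun i _ => hq0 i _
  rw [le_div_iff₀ (by positivity), Finset.sum_mul]
  calc ∑ j ∈ S, (∏ i, q i (j i)) * t ^ 2
      ≤ ∑ j ∈ S, (∏ i, q i (j i)) * (∑ i, (g i (j i) - m i)) ^ 2 := by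
        refine Finset.sum_le_sum fun j hj => ?_
        by_cases h0 : ∏ i, q i (j i) = 0
        · simp [h0]
        · refine mul_le_mul_of_nonneg_left ?_ (hp j)
          rw [Finset.sum_sub_distrib, ← sq_abs (_ - _)]
          exact pow_le_pow_left₀ ht.le (hS j hj h0) 2
    _ ≤ ∑ j : Fin n → ι, (∏ i, q i (j i)) * (∑ i, (g i (j i) - m i)) ^ 2 :=
        Finset.sum_le_sum_of_subset_of_nonneg (Finset.subset_univ _)
          fun j _ _ => mul_nonneg (hp j) (sq_nonneg _)
    _ = ∑ i, ∑ j, q i j * (g i j - m i) ^ 2 :=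
        sum_prod_mul_sq_sum (h := fun i j => g i j - m i) hq hmean
    _ ≤ V := (Finset.sum_le_sum fun i _ => hvar i).trans hV

end Chebyshev

theorem entropyConst_pos : 0 < entropyConst := by
  unfold entropyConst
  have : 0 < Real.logb 2 (Real.exp 1) := Real.logb_pos one_lt_two (Real.one_lt_exp_iff.mpr one_pos)
  positivity

/-- `r log₂² r` is at most the square of `2 (log₂ e) / e` on the unit interval. -/
theorem mul_logb_sq_le {r : ℝ} (h0 : 0 ≤ r) (h1 : r ≤ 1) :
    r * Real.logb 2 r ^ 2 ≤ entropyConst ^ 2 := by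
  rcases h0.eq_or_lt with rfl | hr
  · simp [sq_nonneg]
  set u := √r with hu
  have hu0 : 0 < u := Real.sqrt_pos.mpr hr
  have hu1 : u ≤ 1 := Real.sqrt_le_one.mpr h1
  have hru : r = u ^ 2 := (Real.sq_sqrt h0).symm
  have hlog : -(u * Real.log u) ≤ 1 / Real.exp 1 := by
    have h := Real.log_le_sub_one_of_pos (x := 1 / (Real.exp 1 * u)) (by positivity)
    rw [one_div, Real.log_inv, Real.log_mul (by positivity) hu0.ne', Real.log_exp] at h
    have h' : -Real.log u ≤ (Real.exp 1 * u)⁻¹ := by linarith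
    calc -(u * Real.log u) = u * -Real.log u := by ring
      _ ≤ u * (Real.exp 1 * u)⁻¹ := mul_le_mul_of_nonneg_left h' hu0.le
      _ = 1 / Real.exp 1 := by field_simp
  have hneg : 0 ≤ -(u * Real.log u) := by nlinarith [Real.log_nonpos hu0.le hu1]
  have hl : 0 < Real.log 2 := Real.log_pos one_lt_two
  have e1 : r * Real.logb 2 r ^ 2 = (2 * -(u * Real.log u) / Real.log 2) ^ 2 := by
    rw [hru, Real.logb, Real.log_pow]; push_cast; field_simp
  have e2 : entropyConst = 2 * (1 / Real.exp 1) / Real.log 2 := by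
    rw [entropyConst, Real.logb, Real.log_exp]; field_simp
  rw [e1, e2]
  gcongr

section Spectrum

variable {ι : Type*} [Fintype ι] [DecidableEq ι]

/-- The eigenvalues of a state, with multiplicities. -/
def State.eig (ρ : State ι) : ι → ℝ := ρ.posSemidef.isHermitian.eigenvalues

/-- A unitary matrix whose columns are eigenvectors of a state. -/
def State.basis (ρ : State ι) : Matrix ι ι ℂ := ρ.posSemidef.isHermitian.eigenvectorUnitary

/-- The outcome distribution of the measurement of `ρ` in the eigenbasis of `σ`. -/
def State.measured (σ ρ : State ι) (j : ι) : ℝ := ((σ.basisᴴ * ρ.mat * σ.basis) j j).re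

theorem State.basis_mul_conjTranspose (ρ : State ι) : ρ.basis * ρ.basisᴴ = 1 :=
  Unitary.coe_mul_star_self ρ.posSemidef.isHermitian.eigenvectorUnitary

theorem State.conjTranspose_mul_basis (ρ : State ι) : ρ.basisᴴ * ρ.basis = 1 :=
  Unitary.coe_star_mul_self ρ.posSemidef.isHermitian.eigenvectorUnitary

theorem State.mat_eq (ρ : State ι) :
    ρ.mat = ρ.basis * Matrix.diagonal (fun j => (ρ.eig j : ℂ)) * ρ.basisᴴ := by
  have h := ρ.posSemidef.isHermitian.spectral_theorem
  rw [Unitary.conjStarAlgAut_apply] at h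
  exact h

theorem State.eig_nonneg (ρ : State ι) (j : ι) : 0 ≤ ρ.eig j := ρ.posSemidef.eigenvalues_nonneg j

theorem State.sum_eig (ρ : State ι) : ∑ j, ρ.eig j = 1 := by
  have h := ρ.posSemidef.isHermitian.trace_eq_sum_eigenvalues
  rw [ρ.trace_eq_one] at h
  have h2 := congrArg Complex.re h
  simpa [State.eig] using h2.symm

theorem State.eig_le_one (ρ : State ι) (j : ι) : ρ.eig j ≤ 1 :=
  ρ.sum_eig ▸ Finset.single_le_sum (fun i _ => ρ.eig_nonneg i) (Finset.mem_univ j)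

theorem State.sum_eig_mul_logb (ρ : State ι) :
    ∑ j, ρ.eig j * Real.logb 2 (ρ.eig j) = -ρ.entropy := by
  rw [State.entropy, neg_neg]; rfl

theorem State.sum_eig_mul_logb_sq_le (ρ : State ι) :
    ∑ j, ρ.eig j * Real.logb 2 (ρ.eig j) ^ 2 ≤ Fintype.card ι * entropyConst ^ 2 := by
  refine (Finset.sum_le_sum fun j _ => mul_logb_sq_le (ρ.eig_nonneg j) (ρ.eig_le_one j)).trans ?_
  simp

theorem State.measured_nonneg (σ ρ : State ι) (j : ι) : 0 ≤ σ.measured ρ j :=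
  re_diag_nonneg (ρ.posSemidef.conjTranspose_mul_mul_same _) j

theorem State.ofReal_measured (σ ρ : State ι) (j : ι) :
    (σ.measured ρ j : ℂ) = (σ.basisᴴ * ρ.mat * σ.basis) j j := by
  have h := (ρ.posSemidef.conjTranspose_mul_mul_same σ.basis).diag_nonneg (i := j)
  exact Complex.ext rfl (Complex.nonneg_iff.mp h).2

theorem State.sum_measured (σ ρ : State ι) : ∑ j, σ.measured ρ j = 1 := by
  have h : (σ.basisᴴ * ρ.mat * σ.basis).trace = 1 := by
    rw [Matrix.trace_mul_comm, ← Matrix.mul_assoc, σ.basis_mul_conjTranspose, Matrix.one_mul,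
      ρ.trace_eq_one]
  have h2 := congrArg Complex.re h
  simpa [Matrix.trace, State.measured] using h2

theorem State.measured_self (σ : State ι) (j : ι) : σ.measured σ j = σ.eig j := by
  have : σ.basisᴴ * σ.mat * σ.basis = Matrix.diagonal fun j => (σ.eig j : ℂ) := by
    conv_lhs => rw [σ.mat_eq]
    rw [show σ.basisᴴ * (σ.basis * Matrix.diagonal (fun j => (σ.eig j : ℂ)) * σ.basisᴴ) * σ.basis
      = (σ.basisᴴ * σ.basis) * Matrix.diagonal (fun j => (σ.eig j : ℂ)) * (σ.basisᴴ * σ.basis) by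
        simp only [Matrix.mul_assoc]]
    rw [σ.conjTranspose_mul_basis, Matrix.one_mul, Matrix.mul_one]
  simp [State.measured, this]

theorem State.sum_measured_of_average {n : ℕ} {σ : State ι} {ρ : Fin n → State ι}
    (h : ∑ i, (ρ i).mat = (n : ℂ) • σ.mat) (j : ι) : ∑ i, σ.measured (ρ i) j = n * σ.eig j := by
  have h' : ∑ i, (σ.basisᴴ * (ρ i).mat * σ.basis) = (n : ℂ) • (σ.basisᴴ * σ.mat * σ.basis) := by
    rw [← Finset.sum_mul, ← Finset.mul_sum, h, Matrix.mul_smul, Matrix.smul_mul]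
  have h2 := congrArg (fun A : Matrix ι ι ℂ => (A j j).re) h'
  rw [← σ.measured_self]
  simpa [Matrix.sum_apply, State.measured] using h2

end Spectrum

section Output

variable {ι X : Type*} [Fintype ι] {n : ℕ} (W : Channel X ι) (xs : Fin n → X)

variable [DecidableEq ι]

theorem output_eq : output W xs = tensorPow (fun i => (W (xs i)).basis) *
    Matrix.diagonal (fun j : Fin n → ι => ((∏ i, (W (xs i)).eig (j i) : ℝ) : ℂ)) *
    (tensorPow fun i => (W (xs i)).basis)ᴴ := by
  have : Matrix.diagonal (fun j : Fin n → ι => ((∏ i, (W (xs i)).eig (j i) : ℝ) : ℂ))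
      = tensorPow fun i => Matrix.diagonal fun j => ((W (xs i)).eig j : ℂ) := by
    rw [tensorPow_diagonal]; simp
  rw [this, tensorPow_conjTranspose, tensorPow_mul, tensorPow_mul, output]
  congr 1
  funext i
  exact (W (xs i)).mat_eq

theorem tensorPow_basis_mul_conjTranspose (ρ : Fin n → State ι) :
    tensorPow (fun i => (ρ i).basis) * (tensorPow fun i => (ρ i).basis)ᴴ = 1 := by
  rw [tensorPow_conjTranspose, tensorPow_mul, ← tensorPow_one]
  congr 1
  funext i
  exact (ρ i).basis_mul_conjTranspose

theorem output_posSemidef : (output W xs).PosSemidef := by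
  rw [output_eq]
  refine Matrix.PosSemidef.mul_mul_conjTranspose_same (Matrix.PosSemidef.diagonal fun j => ?_) _
  have : 0 ≤ ∏ i, (W (xs i)).eig (j i) := Finset.prod_nonneg fun i _ => State.eig_nonneg _ _
  exact Complex.zero_le_real.mpr this

/-- An effect of large weight in the output state has large trace: up to the probability of an
atypical event, the eigenvalues of the output state are at most `2 ^ (t - ∑ H(W_{x_i}))`. -/
theorem re_trace_output_mul_le {t : ℝ} (ht : 0 < t) {B : Matrix (Fin n → ι) (Fin n → ι) ℂ}
    (hB : B.PosSemidef) (hB1 : (1 - B).PosSemidef) :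
    ((output W xs * B).trace).re ≤ (2 : ℝ) ^ (t - ∑ i, (W (xs i)).entropy) * B.trace.re
      + n * (Fintype.card ι * entropyConst ^ 2) / t ^ 2 := by
  rw [output_eq]
  refine re_trace_mul_le_of_eigenvalues
    (tensorPow_basis_mul_conjTranspose fun i => W (xs i)) hB hB1 (by positivity) ?_
  refine chebyshev_pi (q := fun i => (W (xs i)).eig)
    (g := fun i j => Real.logb 2 ((W (xs i)).eig j)) (fun i j => State.eig_nonneg _ _)
    (fun i => State.sum_eig _) ht ?_ _ ?_
  · refine (Finset.sum_le_sum fun i _ => State.sum_eig_mul_logb_sq_le _).trans ?_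
    simp
  · intro j hj h0
    have hj := (Finset.mem_filter.mp hj).2
    have hlog := (Real.lt_logb_iff_rpow_lt one_lt_two
      ((by positivity : (0 : ℝ) < 2 ^ (t - ∑ i, (W (xs i)).entropy)).trans hj)).mpr hj
    rw [Real.logb_prod _ _ (Finset.prod_ne_zero_iff.mp h0)] at hlog
    simp_rw [State.sum_eig_mul_logb, Finset.sum_neg_distrib]
    refine le_trans ?_ (le_abs_self _)
    linarith

/-- The index set of the typical eigenvectors of `σ ⊗ ⋯ ⊗ σ`. -/
def typicalSet (σ : State ι) (n : ℕ) (t : ℝ) : Finset (Fin n → ι) :=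
  {j | (2 : ℝ) ^ (-(n * σ.entropy) - t) ≤ ∏ i, σ.eig (j i)}

/-- The projection onto the span of the typical eigenvectors of `σ ⊗ ⋯ ⊗ σ`. -/
def typicalProj (σ : State ι) (n : ℕ) (t : ℝ) : Matrix (Fin n → ι) (Fin n → ι) ℂ :=
  tensorPow (fun _ => σ.basis) *
    Matrix.diagonal (fun j => if j ∈ typicalSet σ n t then (1 : ℂ) else 0) *
    (tensorPow fun _ => σ.basis)ᴴ

theorem card_typicalSet_le (σ : State ι) (n : ℕ) (t : ℝ) :
    ((typicalSet σ n t).card : ℝ) ≤ (2 : ℝ) ^ (n * σ.entropy + t) := by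
  have h1 : ∑ j ∈ typicalSet σ n t, (2 : ℝ) ^ (-(n * σ.entropy) - t) ≤ 1 := by
    rw [← sum_prod_pi_eq_one (n := n) (q := fun _ => σ.eig) fun _ => σ.sum_eig]
    refine (Finset.sum_le_sum fun j hj => (Finset.mem_filter.mp hj).2).trans ?_
    exact Finset.sum_le_sum_of_subset_of_nonneg (Finset.subset_univ _)
      fun j _ _ => Finset.prod_nonneg fun i _ => σ.eig_nonneg _
  rw [Finset.sum_const, nsmul_eq_mul, show -(n * σ.entropy) - t = -(n * σ.entropy + t) by ring,
    Real.rpow_neg zero_le_two, ← div_eq_mul_inv, div_le_one (by positivity)] at h1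
  exact h1

theorem typicalProj_isHermitian (σ : State ι) (n : ℕ) (t : ℝ) :
    (typicalProj σ n t).IsHermitian := by
  refine Matrix.isHermitian_mul_mul_conjTranspose _ (Matrix.isHermitian_diagonal_of_self_adjoint _ ?_)
  refine funext fun j => ?_
  simp only [Pi.star_apply]
  split_ifs <;> simp

theorem typicalProj_mul_self (σ : State ι) (n : ℕ) (t : ℝ) :
    typicalProj σ n t * typicalProj σ n t = typicalProj σ n t := by
  have hU := mul_eq_one_comm.mp (tensorPow_basis_mul_conjTranspose (n := n) fun _ => σ)
  unfold typicalProj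
  generalize (tensorPow fun _ : Fin n => σ.basis) = U at hU ⊢
  have hD : Matrix.diagonal (fun j => if j ∈ typicalSet σ n t then (1 : ℂ) else 0) *
      Matrix.diagonal (fun j => if j ∈ typicalSet σ n t then (1 : ℂ) else 0) =
      Matrix.diagonal (fun j => if j ∈ typicalSet σ n t then (1 : ℂ) else 0) := by
    rw [Matrix.diagonal_mul_diagonal]
    simp
  generalize Matrix.diagonal (fun j => if j ∈ typicalSet σ n t then (1 : ℂ) else 0) = Δ at hD ⊢
  calc U * Δ * Uᴴ * (U * Δ * Uᴴ) = U * Δ * (Uᴴ * U) * Δ * Uᴴ := by simp only [Matrix.mul_assoc]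
    _ = U * (Δ * Δ) * Uᴴ := by rw [hU, Matrix.mul_one, Matrix.mul_assoc U]
    _ = U * Δ * Uᴴ := by rw [hD]

theorem re_trace_typicalProj_le (σ : State ι) (n : ℕ) (t : ℝ) :
    (typicalProj σ n t).trace.re ≤ (2 : ℝ) ^ (n * σ.entropy + t) := by
  refine le_trans (le_of_eq ?_) (card_typicalSet_le σ n t)
  rw [typicalProj, Matrix.trace_mul_comm, ← Matrix.mul_assoc,
    mul_eq_one_comm.mp (tensorPow_basis_mul_conjTranspose (n := n) fun _ => σ), Matrix.one_mul]
  simp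

/-- The output state for an input sequence whose average output is `σ` is concentrated on the
typical subspace of `σ`. -/
theorem re_trace_output_mul_one_sub_typicalProj_le {σ : State ι} {t : ℝ} (ht : 0 < t)
    (h : ∑ i, (W (xs i)).mat = (n : ℂ) • σ.mat) :
    ((output W xs * (1 - typicalProj σ n t)).trace).re
      ≤ n * (Fintype.card ι * entropyConst ^ 2) / t ^ 2 := by
  have hU := tensorPow_basis_mul_conjTranspose (n := n) fun _ => σ
  have hQ : 1 - typicalProj σ n t = tensorPow (fun _ => σ.basis) *
      Matrix.diagonal (fun j => ((if j ∈ typicalSet σ n t then 0 else 1 : ℝ) : ℂ)) *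
      (tensorPow fun _ => σ.basis)ᴴ := by
    rw [typicalProj]
    nth_rewrite 1 [← hU]
    rw [← Matrix.sub_mul]
    congr 1
    nth_rewrite 1 [← Matrix.mul_one (tensorPow fun _ => σ.basis)]
    rw [← Matrix.mul_sub, ← Matrix.diagonal_one, Matrix.diagonal_sub]
    congr 2
    funext j
    split_ifs <;> simp
  have hdiag : ∀ j : Fin n → ι, (((tensorPow fun _ : Fin n => σ.basis)ᴴ * output W xs *
      tensorPow fun _ => σ.basis : Matrix (Fin n → ι) (Fin n → ι) ℂ) j j).re = ∏ i, σ.measured (W (xs i)) (j i) := by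
    intro j
    rw [output, tensorPow_conjTranspose, tensorPow_mul, tensorPow_mul]
    simp only [tensorPow, Matrix.of_apply, ← State.ofReal_measured]
    norm_cast
  rw [Matrix.trace_mul_comm, hQ, re_trace_conj_diagonal_mul]
  simp_rw [hdiag, ite_mul, zero_mul, one_mul]
  rw [show ∑ j, (if j ∈ typicalSet σ n t then 0 else ∏ i, σ.measured (W (xs i)) (j i))
    = ∑ j with j ∉ typicalSet σ n t, ∏ i, σ.measured (W (xs i)) (j i) by
      rw [Finset.sum_filter]; exact Finset.sum_congr rfl fun j _ => by split_ifs <;> simp_all]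
  have havg := State.sum_measured_of_average h
  have hsum : ∀ φ : ι → ℝ, ∑ i, ∑ j, σ.measured (W (xs i)) j * φ j = n * ∑ j, σ.eig j * φ j := by
    intro φ
    rw [Finset.sum_comm, Finset.mul_sum]
    refine Finset.sum_congr rfl fun j _ => ?_
    rw [← Finset.sum_mul, havg, mul_assoc]
  refine chebyshev_pi (g := fun _ j => Real.logb 2 (σ.eig j))
    (fun i j => State.measured_nonneg _ _ _) (fun i => State.sum_measured _ _) ht ?_ _ ?_
  · rw [hsum fun j => Real.logb 2 (σ.eig j) ^ 2]
    exact mul_le_mul_of_nonneg_left (State.sum_eig_mul_logb_sq_le _) (Nat.cast_nonneg _)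
  · intro j hj h0
    have hne : ∏ i, σ.eig (j i) ≠ 0 := by
      refine Finset.prod_ne_zero_iff.mpr fun i _ hi => ?_
      refine Finset.prod_ne_zero_iff.mp h0 i (Finset.mem_univ i) ?_
      have := havg (j i)
      rw [hi, mul_zero] at this
      exact (Finset.sum_eq_zero_iff_of_nonneg fun k _ => State.measured_nonneg _ _ _).mp this i
        (Finset.mem_univ i)
    have hpos : 0 < ∏ i, σ.eig (j i) :=
      lt_of_le_of_ne (Finset.prod_nonneg fun i _ => σ.eig_nonneg _) hne.symm
    have hj : ∏ i, σ.eig (j i) < (2 : ℝ) ^ (-(n * σ.entropy) - t) := by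
      simpa [typicalSet] using hj
    have hlog := (Real.logb_lt_iff_lt_rpow one_lt_two hpos).mpr hj
    rw [Real.logb_prod _ _ (Finset.prod_ne_zero_iff.mp hne)] at hlog
    rw [hsum fun j => Real.logb 2 (σ.eig j), State.sum_eig_mul_logb]
    refine le_trans ?_ (neg_le_abs _)
    linarith

/-- The packing bound: codewords with average output `σ` and total output entropy `h`. -/
theorem card_le_of_average {M : Type*} (T : Finset M) (f : M → Fin n → X)
    (D : M → Matrix (Fin n → ι) (Fin n → ι) ℂ) (hD : ∀ m ∈ T, (D m).PosSemidef)
    (hD1 : (1 - ∑ m ∈ T, D m).PosSemidef) {lam t h : ℝ} (hlam : lam < 1) (ht : 0 < t)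
    (hdec : ∀ m ∈ T, 1 - lam ≤ ((output W (f m) * D m).trace).re) {σ : State ι}
    (hσ : ∀ m ∈ T, ∑ i, (W (f m i)).mat = (n : ℂ) • σ.mat)
    (hh : ∀ m ∈ T, ∑ i, (W (f m i)).entropy = h)
    (hε : n * (Fintype.card ι * entropyConst ^ 2) / t ^ 2 ≤ (1 - lam) / 8) :
    (T.card : ℝ) ≤ 4 / (1 - lam) * (2 : ℝ) ^ (n * σ.entropy - h + 2 * t) := by
  classical
  obtain ⟨Q, hQH, hQQ, hQtr, hQW⟩ : ∃ Q : Matrix (Fin n → ι) (Fin n → ι) ℂ, Q.IsHermitian ∧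
      Q * Q = Q ∧ Q.trace.re ≤ (2 : ℝ) ^ (n * σ.entropy + t) ∧ ∀ m ∈ T,
        ((output W (f m) * (1 - Q)).trace).re ≤ n * (Fintype.card ι * entropyConst ^ 2) / t ^ 2 :=
    ⟨typicalProj σ n t, typicalProj_isHermitian σ n t, typicalProj_mul_self σ n t,
      re_trace_typicalProj_le σ n t,
      fun m hm => re_trace_output_mul_one_sub_typicalProj_le W (f m) ht (hσ m hm)⟩
  have hle : ∀ m ∈ T, (1 - D m).PosSemidef := by
    intro m hm
    have : 1 - D m = (1 - ∑ m ∈ T, D m) + ∑ k ∈ T.erase m, D k := by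
      rw [← Finset.add_sum_erase T D hm]; abel
    rw [this]
    exact hD1.add (Matrix.posSemidef_sum _ fun k hk => hD k (Finset.mem_of_mem_erase hk))
  have hcompl : (1 - Q).PosSemidef := by
    have := Matrix.posSemidef_conjTranspose_mul_self (1 - Q)
    have e : (1 - Q) * (1 - Q) = 1 - Q := by simp [Matrix.mul_sub, Matrix.sub_mul, hQQ]
    rwa [(Matrix.isHermitian_one.sub hQH).eq, e] at this
  have hlow : ∀ m ∈ T, (1 - lam) / 4 * (2 : ℝ) ^ (h - t) ≤ (Q * D m * Q).trace.re := by
    intro m hm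
    have hB : (Q * D m * Q).PosSemidef := by
      have := (hD m hm).mul_mul_conjTranspose_same Q
      rwa [hQH.eq] at this
    have hB1 : (1 - Q * D m * Q).PosSemidef := by
      have h1 := (hle m hm).mul_mul_conjTranspose_same Q
      rw [hQH.eq, Matrix.mul_sub, Matrix.sub_mul, Matrix.mul_one, hQQ] at h1
      have := hcompl.add h1
      rwa [sub_add_sub_cancel] at this
    have p1 := re_trace_mul_le_pinching (output_posSemidef W (f m)) (hD m hm) (hle m hm) hQH hQQ
    have p2 := hQW m hm
    have p3 := re_trace_output_mul_le W (f m) ht hB hB1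
    rw [hh m hm] at p3
    have p4 := hdec m hm
    have p5 : (1 - lam) / 4 ≤ (2 : ℝ) ^ (t - h) * (Q * D m * Q).trace.re := by linarith
    calc (1 - lam) / 4 * (2 : ℝ) ^ (h - t)
        ≤ ((2 : ℝ) ^ (t - h) * (Q * D m * Q).trace.re) * (2 : ℝ) ^ (h - t) :=
          mul_le_mul_of_nonneg_right p5 (by positivity)
      _ = (2 : ℝ) ^ ((t - h) + (h - t)) * (Q * D m * Q).trace.re := by
          rw [Real.rpow_add two_pos]; ring
      _ = (Q * D m * Q).trace.re := by simp
  have hsum : ∑ m ∈ T, (Q * D m * Q).trace.re ≤ (2 : ℝ) ^ (n * σ.entropy + t) := by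
    refine le_trans ?_ hQtr
    have h1 := (hD1.mul_mul_conjTranspose_same Q).trace_nonneg
    rw [hQH.eq, Matrix.mul_sub, Matrix.sub_mul, Matrix.mul_one, hQQ, Finset.mul_sum,
      Finset.sum_mul, Matrix.trace_sub, Matrix.trace_sum] at h1
    have h2 := (Complex.nonneg_iff.mp h1).1
    rw [Complex.sub_re, Complex.re_sum] at h2
    linarith
  have h1 : (T.card : ℝ) * ((1 - lam) / 4 * (2 : ℝ) ^ (h - t)) ≤ (2 : ℝ) ^ (n * σ.entropy + t) := by
    refine le_trans ?_ hsum
    rw [← nsmul_eq_mul]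
    exact Finset.card_nsmul_le_sum T _ _ hlow
  have hl : 0 < 1 - lam := by linarith
  rw [← le_div_iff₀ (by positivity)] at h1
  refine h1.trans (le_of_eq ?_)
  rw [show n * σ.entropy - h + 2 * t = (n * σ.entropy + t) - (h - t) by ring,
    Real.rpow_sub two_pos (n * σ.entropy + t)]
  field_simp

end Output

section Types

variable {X : Type*} [DecidableEq X] {n : ℕ}

theorem natCast_mul_seqType (hn : 1 ≤ n) (xs : Fin n → X) (x : X) :
    (n : ℝ) * seqType xs x = (Finset.univ.filter fun i => xs i = x).card := by
  have : (n : ℝ) ≠ 0 := by positivity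
  rw [seqType]
  field_simp

variable [Fintype X]

theorem sum_comp_eq_sum_card_nsmul {A : Type*} [AddCommMonoid A] (xs : Fin n → X) (φ : X → A) :
    ∑ i, φ (xs i) = ∑ x, (Finset.univ.filter fun i => xs i = x).card • φ x := by
  rw [← Finset.sum_fiberwise Finset.univ xs]
  refine Finset.sum_congr rfl fun x _ => ?_
  rw [← Finset.sum_const]
  exact Finset.sum_congr rfl fun i hi => by rw [(Finset.mem_filter.mp hi).2]

theorem seqType_mem_stdSimplex (hn : 1 ≤ n) (xs : Fin n → X) : seqType xs ∈ stdSimplex ℝ X := by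
  refine ⟨fun x => by unfold seqType; positivity, ?_⟩
  have h := sum_comp_eq_sum_card_nsmul xs fun _ => (1 : ℝ)
  have hn0 : (n : ℝ) ≠ 0 := by positivity
  unfold seqType
  rw [← Finset.sum_div, div_eq_one_iff_eq hn0]
  simpa using h.symm

theorem sum_comp_eq_mul_sum_type (hn : 1 ≤ n) {xs : Fin n → X} {P : X → ℝ} (h : seqType xs = P)
    (φ : X → ℝ) : ∑ i, φ (xs i) = n * ∑ x, P x * φ x := by
  subst h
  rw [sum_comp_eq_sum_card_nsmul, Finset.mul_sum]
  refine Finset.sum_congr rfl fun x _ => ?_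
  rw [← mul_assoc, natCast_mul_seqType hn, nsmul_eq_mul]

theorem sum_mat_eq_smul_avgState {ι : Type*} [Fintype ι] (hn : 1 ≤ n) {xs : Fin n → X}
    {P : stdSimplex ℝ X} (h : seqType xs = P.1) (W : Channel X ι) :
    ∑ i, (W (xs i)).mat = (n : ℂ) • (avgState P W).mat := by
  rw [sum_comp_eq_sum_card_nsmul xs fun x => (W x).mat]
  simp only [avgState]
  rw [Finset.smul_sum]
  refine Finset.sum_congr rfl fun x _ => ?_
  have := natCast_mul_seqType hn xs x
  rw [smul_smul, ← h, ← Complex.ofReal_natCast, ← Complex.ofReal_mul, this, Complex.ofReal_natCast,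
    Nat.cast_smul_eq_nsmul]

end Types

namespace BlockCode

variable {X ι M' : Type*} [Fintype ι] [DecidableEq ι] [Fintype M'] {n : ℕ}

theorem IsCode.one_sub_le {c : BlockCode X ι M' n} {W : Channel X ι} {lam : ℝ}
    (h : c.IsCode W lam) (m : c.messages) : 1 - lam ≤ ((output W (c.f m) * c.D m).trace).re := by
  have h1 := (le_ciSup (Set.finite_range fun m : c.messages =>
    1 - ((output W (c.f m) * c.D m).trace).re).bddAbove m).trans h
  linarith

theorem one_sub_sum_posSemidef (c : BlockCode X ι M' n) (T : Finset c.messages) :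
    (1 - ∑ m ∈ T, c.D m).PosSemidef := by
  classical
  have h := Finset.sum_map T (Function.Embedding.subtype (· ∈ c.messages)) c.D
  simp only [Function.Embedding.subtype_apply] at h
  rw [← h, ← c.sum_eq_one, ← Finset.sum_compl_add_sum (T.map _), add_sub_cancel_right]
  exact Matrix.posSemidef_sum _ fun m _ => c.posSemidef m

/-- The strong converse for messages whose codewords have the same type. -/
theorem IsCode.card_le_of_seqType [Fintype X] [DecidableEq X] {c : BlockCode X ι M' n}
    {W : Channel X ι} {lam : ℝ} (h : c.IsCode W lam) (hlam0 : 0 < lam) (hlam1 : lam < 1)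
    (hn : 1 ≤ n) {P : stdSimplex ℝ X} (T : Finset c.messages)
    (hT : ∀ m ∈ T, seqType (c.f m) = P.1) {a d δ : ℝ} (ha : a = Fintype.card X)
    (hd : d = Fintype.card ι) (hδ : δ = √(32 * a * d) / (1 - lam)) :
    (T.card : ℝ) ≤ 4 / (1 - lam) * (2 : ℝ) ^ ((n : ℝ) * mutualInfo P W
      + 2 * entropyConst * d * √a * δ * √(n : ℝ)) := by
  have hl : 0 < 1 - lam := by linarith
  rcases T.eq_empty_or_nonempty with rfl | ⟨m₀, _⟩
  · simp; positivity
  have hn0 : (0 : ℝ) < n := by positivity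
  have : Nonempty X := ⟨c.f m₀ ⟨0, hn⟩⟩
  have hι : Nonempty ι := by
    by_contra hι
    rw [not_nonempty_iff] at hι
    have := (W (Classical.arbitrary X)).trace_eq_one
    simp [Matrix.trace] at this
  have ha1 : 1 ≤ a := by rw [ha]; exact_mod_cast Fintype.card_pos
  have hd1 : 1 ≤ d := by rw [hd]; exact_mod_cast Fintype.card_pos
  have hδ0 : 0 < δ := by rw [hδ]; positivity
  have hκ := entropyConst_pos
  have hε : n * (Fintype.card ι * entropyConst ^ 2) /
      (entropyConst * d * √a * δ * √(n : ℝ)) ^ 2 ≤ (1 - lam) / 8 := by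
    have e : (entropyConst * d * √a * δ * √(n : ℝ)) ^ 2
        = entropyConst ^ 2 * d ^ 2 * a * (32 * a * d / (1 - lam) ^ 2) * n := by
      rw [mul_pow, mul_pow, mul_pow, mul_pow, Real.sq_sqrt (by positivity),
        Real.sq_sqrt (by positivity), hδ, div_pow, Real.sq_sqrt (by positivity)]
    rw [e, ← hd]
    have e2 : n * (d * entropyConst ^ 2) /
        (entropyConst ^ 2 * d ^ 2 * a * (32 * a * d / (1 - lam) ^ 2) * n)
        = (1 - lam) / 8 * ((1 - lam) / (4 * (a ^ 2 * d ^ 2))) := by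
      field_simp; ring
    rw [e2]
    refine mul_le_of_le_one_right (by positivity) ?_
    rw [div_le_one (by positivity)]
    have h1 : 1 ≤ a ^ 2 * d ^ 2 := one_le_mul_of_one_le_of_one_le (one_le_pow₀ ha1)
      (one_le_pow₀ hd1)
    linarith
  have key := card_le_of_average W T c.f (fun m => c.D m) (fun m _ => c.posSemidef m)
    (c.one_sub_sum_posSemidef T) (h := n * condEntropy P W) hlam1 (by positivity)
    (fun m _ => h.one_sub_le m)
    (fun m hm => sum_mat_eq_smul_avgState hn (hT m hm) W)
    (fun m hm => sum_comp_eq_mul_sum_type hn (hT m hm) fun x => (W x).entropy) hε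
  convert key using 3
  rw [mutualInfo]
  ring

end BlockCode

theorem natCast_add_one_le_two_rpow {n : ℕ} (hn : 1 ≤ n) :
    (n : ℝ) + 1 ≤ (2 : ℝ) ^ (2 * √(n : ℝ)) := by
  have hs : 1 ≤ √(n : ℝ) := Real.one_le_sqrt.mpr (by exact_mod_cast hn)
  have h := one_add_mul_self_le_rpow_one_add (s := 1) (by norm_num) hs
  rw [mul_one, one_add_one_eq_two] at h
  have h2 : (2 : ℝ) ^ (2 * √(n : ℝ)) = ((2 : ℝ) ^ √(n : ℝ)) ^ 2 := by
    rw [mul_comm, Real.rpow_mul zero_le_two]; norm_num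
  rw [h2]
  nlinarith [Real.sq_sqrt (Nat.cast_nonneg (α := ℝ) n)]

/-- The strong converse, with an explicit constant. -/
theorem BlockCode.IsCode.card_messages_le {X ι M' : Type*} [Fintype X] [Fintype ι] [DecidableEq ι]
    [Fintype M'] {n : ℕ} {c : BlockCode X ι M' n} {W : Channel X ι} {lam : ℝ}
    (h : c.IsCode W lam) (hlam0 : 0 < lam) (hlam1 : lam < 1) (hn : 1 ≤ n) {a d δ : ℝ}
    (ha : a = Fintype.card X) (hd : d = Fintype.card ι) (hδ : δ = √(32 * a * d) / (1 - lam)) :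
    (c.messages.card : ℝ) ≤ (2 : ℝ) ^ ((n : ℝ) * capacity W +
      (2 * a + Real.logb 2 (4 / (1 - lam)) + 2 * entropyConst * d * √a * δ) * √(n : ℝ)) := by
  classical
  have hl : 0 < 1 - lam := by linarith
  set R := 4 / (1 - lam) * (2 : ℝ) ^ ((n : ℝ) * capacity W
    + 2 * entropyConst * d * √a * δ * √(n : ℝ)) with hR
  let k : c.messages → X → Fin (n + 1) := fun m x =>
    ⟨(Finset.univ.filter fun i => c.f m i = x).card,
      Nat.lt_succ_of_le ((Finset.card_le_univ _).trans (Fintype.card_fin n).le)⟩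
  have hfib : ∀ b, ((Finset.univ.filter fun m => k m = b).card : ℝ) ≤ R := by
    intro b
    rcases (Finset.univ.filter fun m => k m = b).eq_empty_or_nonempty with hT | ⟨m₀, hm₀⟩
    · rw [hT]; simp [hR]; positivity
    refine (h.card_le_of_seqType hlam0 hlam1 hn
      (P := ⟨seqType (c.f m₀), seqType_mem_stdSimplex hn _⟩) _ ?_ ha hd hδ).trans ?_
    · intro m hm
      funext x
      have e : k m = k m₀ := (Finset.mem_filter.mp hm).2.trans (Finset.mem_filter.mp hm₀).2.symm
      have := congrArg (fun φ : X → Fin (n + 1) => ((φ x : ℕ) : ℝ)) e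
      simp only [k] at this
      simp only [seqType, this]
    · rw [hR]
      have := le_ciSup (bddAbove_mutualInfo W) ⟨seqType (c.f m₀), seqType_mem_stdSimplex hn _⟩
      have : mutualInfo ⟨seqType (c.f m₀), seqType_mem_stdSimplex hn _⟩ W ≤ capacity W := this
      gcongr
      norm_num
  have hcard : (c.messages.card : ℝ) ≤ ((n : ℝ) + 1) ^ Fintype.card X * R := by
    have e := Finset.card_eq_sum_card_fiberwise (s := (Finset.univ : Finset c.messages)) (f := k)
      (t := Finset.univ) (fun _ _ => Finset.mem_coe.mpr (Finset.mem_univ _))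
    rw [Finset.card_univ, Fintype.card_coe] at e
    rw [e, Nat.cast_sum]
    refine (Finset.sum_le_sum fun b _ => hfib b).trans ?_
    simp
  have hs : 1 ≤ √(n : ℝ) := Real.one_le_sqrt.mpr (by exact_mod_cast hn)
  have h1 : ((n : ℝ) + 1) ^ Fintype.card X ≤ (2 : ℝ) ^ (2 * a * √(n : ℝ)) := by
    rw [show 2 * a * √(n : ℝ) = 2 * √(n : ℝ) * (Fintype.card X : ℝ) by rw [ha]; ring,
      Real.rpow_mul zero_le_two, Real.rpow_natCast]
    exact pow_le_pow_left₀ (by positivity) (natCast_add_one_le_two_rpow hn) _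
  have h2 : 4 / (1 - lam) ≤ (2 : ℝ) ^ (Real.logb 2 (4 / (1 - lam)) * √(n : ℝ)) := by
    conv_lhs => rw [← Real.rpow_logb two_pos (by norm_num) (show 0 < 4 / (1 - lam) by positivity)]
    refine Real.rpow_le_rpow_of_exponent_le one_le_two (le_mul_of_one_le_right ?_ hs)
    refine Real.logb_nonneg one_lt_two ?_
    rw [le_div_iff₀ hl]
    linarith
  refine hcard.trans ?_
  rw [show (n : ℝ) * capacity W + (2 * a + Real.logb 2 (4 / (1 - lam)) +
      2 * entropyConst * d * √a * δ) * √(n : ℝ) = 2 * a * √(n : ℝ) +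
      (Real.logb 2 (4 / (1 - lam)) * √(n : ℝ) + ((n : ℝ) * capacity W +
        2 * entropyConst * d * √a * δ * √(n : ℝ))) by ring,
    Real.rpow_add two_pos, Real.rpow_add two_pos (Real.logb 2 (4 / (1 - lam)) * √(n : ℝ)), hR]
  gcongr

end CQ

end

theorem mainTheorem3 (lam : ℝ) (hlam0 : 0 < lam) (hlam1 : lam < 1) :
    (∀ a d : ℕ, ∃ K : ℝ,
      ∀ (X ι : Type*) [Fintype X] [Nonempty X] [Fintype ι] [DecidableEq ι],
        Fintype.card X = a → Fintype.card ι = d →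
        ∀ (W : CQ.Channel X ι) (n : ℕ), 1 ≤ n →
        ∀ (M' : Type*) [Fintype M'] (c : CQ.BlockCode X ι M' n), c.IsCode W lam →
          (c.messages.card : ℝ) ≤ (2 : ℝ) ^ ((n : ℝ) * CQ.capacity W + K * √(n : ℝ)))
    ∧
    (∀ (X ι : Type*) [Fintype X] [DecidableEq X] [Nonempty X] [Fintype ι] [DecidableEq ι]
        (W : CQ.Channel X ι) (P : stdSimplex ℝ X) (n : ℕ), 1 ≤ n →
        ∀ (M' : Type*) [Fintype M'] (c : CQ.BlockCode X ι M' n), c.IsCode W lam →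
          (∀ m, CQ.seqType (c.f m) = P.1) →
          ∀ (a d δ : ℝ), a = Fintype.card X → d = Fintype.card ι →
            δ = √(32 * a * d) / (1 - lam) →
            (c.messages.card : ℝ) ≤ 4 / (1 - lam) *
              (2 : ℝ) ^ ((n : ℝ) * CQ.mutualInfo P W
                + 2 * CQ.entropyConst * d * √a * δ * √(n : ℝ))) := by
  refine ⟨fun a d => ⟨2 * (a : ℝ) + Real.logb 2 (4 / (1 - lam)) +
    2 * CQ.entropyConst * d * √(a : ℝ) * (√(32 * a * d) / (1 - lam)), ?_⟩, ?_⟩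
  · intro X ι _ _ _ _ ha hd W n hn M' _ c hc
    exact hc.card_messages_le hlam0 hlam1 hn (congrArg _ ha.symm) (congrArg _ hd.symm) rfl
  · intro X ι _ _ _ _ _ W P n hn M' _ c hc htype a d δ ha hd hδ
    have := hc.card_le_of_seqType hlam0 hlam1 hn Finset.univ (fun m _ => htype m) ha hd hδ
    rwa [Finset.card_univ, Fintype.card_coe] at this
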